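/- Let $A=\mathbb{F}_2[x,y]/(y^2+y=x^3+x+1)$, let $K$ be its fraction field, and let $\deg a=-v_\infty(a)$ be the degree on $A$ at the unique place $\infty$ at infinity, so that $\deg x=2$, $\deg y=3$, $\deg(p(x)+q(x)y)=\max(2\deg p,\,2\deg q+3)$ and $\deg 0=-\infty$. Let $K\{\tau\}$ be the ring of twisted polynomials, $\tau c=c^2\tau$ for $c\in K$, acting by $\left(\sum_i c_i\tau^i\right)(f)=\sum_i c_i f^{2^i}$, and let $\rho\colon A\to K\{\tau\}$, $a\mapsto\rho_a$, be the rank one Drinfeld module (ring homomorphism) with $$\rho_x=x+(x^2+x)\tau+\tau^2,\qquad \rho_y=y+(y^2+y)\tau+x(y^2+y)\tau^2+\tau^3 .$$ Let $e(z)=\sum_{i\ge0} z^{2^i}/d_i$, with $d_0=1$, be its normalized exponential, i.e. the unique power series of this shape over $K$ with $e(az)=\rho_a(e(z))$ for all $a\in A$, and let $\log(z)=\sum_{i\ge0} z^{2^i}/\ell_i$ be its compositional inverse, $e(\log z)=z$. For $k\ge 0$ put $$p_k(w)=\sum_{j=0}^{k}\frac{w^{2^j}}{d_j\,\ell_{k-j}^{2^j}},\qquad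 e_k(w)=\prod_{a\in A,\ \deg a<k}(w+a),$$ and let $B_{k,i}$ be the coefficient of $w^{2^i}$ in $e_k(w)$. Then all $d_j$ and $\ell_j$ are well defined and nonzero (that is, all the coefficients $1/d_j$ of $e$ and $1/\ell_j$ of $\log$ are nonzero), and for every $k\ge2$ the polynomial $e_k$ divides $p_k$ in $K[w]$, and the quotient $R_k=p_k/e_k$ is $$R_k(w)=\frac{1}{d_k}\,e_k(w)+C,\qquad C=\frac{1}{d_{k-1}}+\frac{B_{k,k-2}^2}{d_k}.$$ Equivalently, $p_k(w)=\dfrac{e_k(w)^2}{d_k}+C\,e_k(w)$. -/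

import Mathlib

open Polynomial

noncomputable section

namespace DrinfeldExample

/-- The elliptic curve `y² + y = x³ + x + 1` over `𝔽₂`. -/
def curve : WeierstrassCurve.Affine (ZMod 2) := ⟨0, 0, 1, 1, 1⟩

/-- The ring `A = 𝔽₂[x, y] / (y² + y = x³ + x + 1)`. -/
abbrev A : Type := curve.CoordinateRing

/-- The fraction field of `A`. -/
abbrev K : Type := curve.FunctionField

/-- The element `x` of `A`. -/
def xA : A := WeierstrassCurve.Affine.CoordinateRing.mk curve (C X)

/-- The element `y` of `A`. -/
def yA : A := WeierstrassCurve.Affine.CoordinateRing.mk curve X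

/-- `x` as an element of the fraction field. -/
def xK : K := algebraMap A K xA

/-- `y` as an element of the fraction field. -/
def yK : K := algebraMap A K yA

/-- The degree `deg a = -v_∞(a)` on `A`, computed as the degree of the norm from `A` to `𝔽₂[x]`
(the place `∞` is the only one above that of `𝔽₂(x)`, with residue degree one).
Thus `deg 0 = ⊥`. -/
def deg (a : A) : WithBot ℕ := (Algebra.norm (ZMod 2)[X] a).degree

/-- Explicitly `deg (p(x) + q(x) y) = max (2 deg p) (2 deg q + 3)`. -/
theorem deg_eq (p q : (ZMod 2)[X]) :
    deg (p • (1 : A) + q • yA) = max (2 • p.degree) (2 • q.degree + 3) :=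
  WeierstrassCurve.Affine.CoordinateRing.degree_norm_smul_basis p q

theorem deg_xA : deg xA = 2 := by
  have h := deg_eq X 0
  have h1 : (X : (ZMod 2)[X]) • (1 : A) + (0 : (ZMod 2)[X]) • yA = xA := by
    rw [zero_smul, add_zero, WeierstrassCurve.Affine.CoordinateRing.smul, mul_one]; rfl
  rw [h1] at h
  rw [h]; simp

theorem deg_yA : deg yA = 3 := by
  have h := deg_eq 0 1
  rw [zero_smul, zero_add, one_smul] at h
  rw [h]; simp

theorem finite_deg_lt (k : ℕ) : {a : A | deg a < k}.Finite := by
  have hf : (Polynomial.degreeLT (ZMod 2) k : Set (ZMod 2)[X]).Finite := by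
    have : Finite (Polynomial.degreeLT (ZMod 2) k) :=
      Finite.of_equiv _ (Polynomial.degreeLTEquiv (ZMod 2) k).toEquiv.symm
    exact Set.toFinite _
  refine ((hf.prod hf).image
    (fun pq : (ZMod 2)[X] × (ZMod 2)[X] => pq.1 • (1 : A) + pq.2 • yA)).subset ?_
  intro a ha
  obtain ⟨p, q, rfl⟩ := WeierstrassCurve.Affine.CoordinateRing.exists_smul_basis_eq a
  have ha' : max (2 • p.degree) (2 • q.degree + 3) < (k : WithBot ℕ) := by
    rw [← deg_eq]; exact ha
  obtain ⟨h1, h2⟩ := max_lt_iff.mp ha'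
  refine ⟨(p, q), ⟨?_, ?_⟩, rfl⟩
  · rw [SetLike.mem_coe, Polynomial.mem_degreeLT]
    induction hp : p.degree with
    | bot => exact WithBot.bot_lt_coe k
    | coe n =>
      rw [hp] at h1
      rw [two_nsmul] at h1
      have h1' : n + n < k := WithBot.coe_lt_coe.mp h1
      have : n < k := by omega
      exact WithBot.coe_lt_coe.mpr this
  · rw [SetLike.mem_coe, Polynomial.mem_degreeLT]
    induction hq : q.degree with
    | bot => exact WithBot.bot_lt_coe k
    | coe n =>
      rw [hq] at h2
      rw [two_nsmul] at h2
      have h2' : n + n + 3 < k := WithBot.coe_lt_coe.mp h2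
      have : n < k := by omega
      exact WithBot.coe_lt_coe.mpr this

/-- `A_{<k} = {a ∈ A : deg a < k}`. -/
def Alt (k : ℕ) : Finset A := (finite_deg_lt k).toFinset

/-- `e_k(w) = ∏_{deg a < k} (w + a)`. -/
def ePoly (k : ℕ) : K[X] := ∏ a ∈ Alt k, (X + C (algebraMap A K a))

/-- `B_{k,i}`, the coefficient of `w^(2^i)` in `e_k(w)`. -/
def B (k i : ℕ) : K := (ePoly k).coeff (2 ^ i)

theorem curve_eq : yK ^ 2 + yK = xK ^ 3 + xK + 1 := by
  have h : yA ^ 2 + yA = xA ^ 3 + xA + 1 := by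
    have h0 : WeierstrassCurve.Affine.CoordinateRing.mk curve curve.polynomial = 0 :=
      AdjoinRoot.mk_self
    simp only [WeierstrassCurve.Affine.polynomial, curve, map_add, map_pow, map_one, map_zero, zero_mul, zero_add,
      one_mul, add_zero] at h0
    exact sub_eq_zero.mp h0
  have := congrArg (algebraMap A K) h
  simpa [xK, yK] using this

instance : CharP K 2 := charP_of_injective_algebraMap (algebraMap (ZMod 2) K).injective 2

instance : CharP (PowerSeries K) 2 :=
  charP_of_injective_algebraMap (algebraMap K (PowerSeries K)).injective 2

/-- The ring of `𝔽₂`-linear endomorphisms of `K⟦z⟧` under composition. A twisted polynomial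
`∑ cᵢ τⁱ` over `K` is identified with the endomorphism `f ↦ ∑ cᵢ f^(2^i)`; this identification is
faithful, and composition is governed by `τ c = c² τ`. -/
abbrev TwistedEnd : Type := Module.End (ZMod 2) (PowerSeries K)

/-- Multiplication by a constant `c ∈ K`. -/
def scalar (c : K) : TwistedEnd := LinearMap.mulLeft (ZMod 2) (PowerSeries.C c)

/-- The Frobenius `τ : f ↦ f²`. -/
def τ : TwistedEnd := (FiniteField.frobeniusAlgHom (ZMod 2) (PowerSeries K)).toLinearMap

@[simp] theorem scalar_apply (c : K) (f : PowerSeries K) : scalar c f = PowerSeries.C c * f := rfl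

@[simp] theorem τ_apply (f : PowerSeries K) : τ f = f ^ 2 := by simp [τ]

theorem τ_mul_scalar (c : K) : τ * scalar c = scalar (c ^ 2) * τ := by
  ext1 f; simp [mul_pow]

/-- `ρ_x = x + (x² + x) τ + τ²`. -/
def rhoX : TwistedEnd := scalar xK + scalar (xK ^ 2 + xK) * τ + τ ^ 2

/-- `ρ_y = y + (y² + y) τ + x (y² + y) τ² + τ³`. -/
def rhoY : TwistedEnd :=
  scalar yK + scalar (yK ^ 2 + yK) * τ + scalar (xK * (yK ^ 2 + yK)) * τ ^ 2 + τ ^ 3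

theorem rhoX_apply (f : PowerSeries K) : rhoX f =
    PowerSeries.C xK * f + PowerSeries.C (xK ^ 2 + xK) * f ^ 2 + f ^ 4 := by
  simp only [rhoX, pow_two τ, LinearMap.add_apply, Module.End.mul_apply, scalar_apply, τ_apply]
  ring

theorem rhoY_apply (f : PowerSeries K) : rhoY f =
    PowerSeries.C yK * f + PowerSeries.C (yK ^ 2 + yK) * f ^ 2
      + PowerSeries.C (xK * (yK ^ 2 + yK)) * f ^ 4 + f ^ 8 := by
  simp only [rhoY, pow_succ τ, pow_zero, one_mul, LinearMap.add_apply, Module.End.mul_apply,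
    scalar_apply, τ_apply]
  ring

theorem comm_aux {R : Type*} [CommRing R] [CharP R 2] (x y f g h : R) (hy : y ^ 2 = y + (x ^ 3 + x + 1))
   (hg : g = y * f + (y^2+y) * f^2 + x*(y^2+y)*f^4 + f^8)
   (hh : h = x * f + (x^2+x) * f^2 + f^4) :
   x * g + (x^2+x) * g^2 + g^4 = y * h + (y^2+y) * h^2 + x*(y^2+y)*h^4 + h^8 := by
  have h2 : (2:R) = 0 := CharTwo.two_eq_zero
  have hv : y^2 + y = x^3+x+1 := by linear_combination hy + y * h2
  have y4 : y ^ 4 = y + (x^3+x+1) + (x^6+x^2+1) := by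
    have : y^4 = (y^2)^2 := by ring
    rw [this, hy, CharTwo.add_sq, CharTwo.add_sq, CharTwo.add_sq, hy]; ring
  rw [hv] at hg ⊢
  have g2 : g^2 = y^2 * f^2 + (x^6+x^2+1) * f^4 + x^2*(x^6+x^2+1)*f^8 + f^16 := by
    rw [hg]; simp only [CharTwo.add_sq, mul_pow]; ring
  have g4 : g^4 = y^4 * f^4 + (x^12+x^4+1) * f^8 + x^4*(x^12+x^4+1)*f^16 + f^32 := by
    rw [show g^4 = (g^2)^2 by ring, g2]; simp only [CharTwo.add_sq, mul_pow]; ring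
  have e2 : h^2 = x^2 * f^2 + (x^4+x^2) * f^4 + f^8 := by
    rw [hh]; simp only [CharTwo.add_sq, mul_pow]; ring
  have e4 : h^4 = x^4 * f^4 + (x^8+x^4) * f^8 + f^16 := by
    rw [show h^4 = (h^2)^2 by ring, e2]; simp only [CharTwo.add_sq, mul_pow]; ring
  have e8 : h^8 = x^8 * f^8 + (x^16+x^8) * f^16 + f^32 := by
    rw [show h^8 = (h^4)^2 by ring, e4]; simp only [CharTwo.add_sq, mul_pow]; ring
  rw [g4, g2, e8, e4, e2, hg, hh, y4, hy]
  rw [← sub_eq_zero]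
  ring_nf
  simp [h2]

theorem rel_aux {R : Type*} [CommRing R] [CharP R 2] (x y f g h k : R) (hy : y ^ 2 = y + (x ^ 3 + x + 1))
   (hg : g = y * f + (y^2+y) * f^2 + x*(y^2+y)*f^4 + f^8)
   (hh : h = x * f + (x^2+x) * f^2 + f^4) (hk : k = x * h + (x^2+x) * h^2 + h^4) :
   (y * g + (y^2+y) * g^2 + x*(y^2+y)*g^4 + g^8) + g = (x * k + (x^2+x) * k^2 + k^4) + h + f := by
  have h2 : (2:R) = 0 := CharTwo.two_eq_zero
  have hv : y^2 + y = x^3+x+1 := by linear_combination hy + y * h2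
  have y4 : y ^ 4 = y + (x^3+x+1) + (x^6+x^2+1) := by
    have : y^4 = (y^2)^2 := by ring
    rw [this, hy, CharTwo.add_sq, CharTwo.add_sq, CharTwo.add_sq, hy]; ring
  have y8 : y ^ 8 = y + (x^3+x+1) + (x^6+x^2+1) + (x^12+x^4+1):= by
    have : y^8 = (y^4)^2 := by ring
    rw [this, y4]; simp only [CharTwo.add_sq, hy]; ring
  rw [hv] at hg ⊢
  have g2 : g^2 = y^2 * f^2 + (x^6+x^2+1) * f^4 + x^2*(x^6+x^2+1)*f^8 + f^16 := by
    rw [hg]; simp only [CharTwo.add_sq, mul_pow]; ring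
  have g4 : g^4 = y^4 * f^4 + (x^12+x^4+1) * f^8 + x^4*(x^12+x^4+1)*f^16 + f^32 := by
    rw [show g^4 = (g^2)^2 by ring, g2]; simp only [CharTwo.add_sq, mul_pow]; ring
  have g8 : g^8 = y^8 * f^8 + (x^24+x^8+1) * f^16 + x^8*(x^24+x^8+1)*f^32 + f^64 := by
    rw [show g^8 = (g^4)^2 by ring, g4]; simp only [CharTwo.add_sq, mul_pow]; ring
  have e2 : h^2 = x^2 * f^2 + (x^4+x^2) * f^4 + f^8 := by
    rw [hh]; simp only [CharTwo.add_sq, mul_pow]; ring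
  have e4 : h^4 = x^4 * f^4 + (x^8+x^4) * f^8 + f^16 := by
    rw [show h^4 = (h^2)^2 by ring, e2]; simp only [CharTwo.add_sq, mul_pow]; ring
  have e8 : h^8 = x^8 * f^8 + (x^16+x^8) * f^16 + f^32 := by
    rw [show h^8 = (h^4)^2 by ring, e4]; simp only [CharTwo.add_sq, mul_pow]; ring
  have e16 : h^16 = x^16 * f^16 + (x^32+x^16) * f^32 + f^64 := by
    rw [show h^16 = (h^8)^2 by ring, e8]; simp only [CharTwo.add_sq, mul_pow]; ring
  have k2 : k^2 = x^2 * h^2 + (x^4+x^2) * h^4 + h^8 := by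
    rw [hk]; simp only [CharTwo.add_sq, mul_pow]; ring
  have k4 : k^4 = x^4 * h^4 + (x^8+x^4) * h^8 + h^16 := by
    rw [show k^4 = (k^2)^2 by ring, k2]; simp only [CharTwo.add_sq, mul_pow]; ring
  rw [k4, k2, hk, e16, g8, g4, g2, e8, e4, e2, hg, hh, y8, y4]
  have : y * (y * f) = y^2 * f := by ring
  rw [← sub_eq_zero]
  simp only [mul_add, this, hy]
  ring_nf
  simp [h2, show (4 : R) = 2 * 2 by norm_num]

theorem curve_eq_series : (PowerSeries.C yK : PowerSeries K) ^ 2 = PowerSeries.C yK +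
    ((PowerSeries.C xK) ^ 3 + PowerSeries.C xK + 1) := by
  have h2 : (2 : K) = 0 := CharTwo.two_eq_zero
  have h : yK ^ 2 = yK + (xK ^ 3 + xK + 1) := by linear_combination curve_eq - yK * h2
  simpa using congrArg (PowerSeries.C : K →+* PowerSeries K) h

theorem rho_commute : Commute rhoX rhoY := by
  refine LinearMap.ext fun f => ?_
  simp only [Module.End.mul_apply]
  rw [rhoX_apply (rhoY f), rhoY_apply (rhoX f)]
  simp only [map_add, map_mul, map_pow]
  refine comm_aux _ _ f _ _ curve_eq_series ?_ ?_
  · rw [rhoY_apply]; simp only [map_add, map_mul, map_pow]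
  · rw [rhoX_apply]; simp only [map_add, map_pow]

theorem rho_relation : rhoY ^ 2 + rhoY = rhoX ^ 3 + rhoX + 1 := by
  refine LinearMap.ext fun f => ?_
  simp only [pow_succ, pow_zero, one_mul, LinearMap.add_apply, Module.End.mul_apply,
    Module.End.one_apply]
  rw [rhoX_apply (rhoX (rhoX f)), rhoY_apply (rhoY f)]
  simp only [map_add, map_mul, map_pow]
  refine rel_aux _ _ f _ _ _ curve_eq_series ?_ ?_ ?_
  · rw [rhoY_apply]; simp only [map_add, map_mul, map_pow]
  · rw [rhoX_apply]; simp only [map_add, map_pow]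
  · rw [rhoX_apply (rhoX f)]; simp only [map_add, map_pow]

theorem commute_aeval (p : (ZMod 2)[X]) : Commute (aeval rhoX p) rhoY := by
  induction p using Polynomial.induction_on' with
  | add p q hp hq => rw [map_add]; exact hp.add_left hq
  | monomial n c =>
    rw [aeval_monomial]
    exact Commute.mul_left (Algebra.commutes c rhoY) (rho_commute.pow_left n)

/-- The ring homomorphism `𝔽₂[x][y] → K{τ}` with `x ↦ ρ_x`, `y ↦ ρ_y`. -/
def rhoFree : (ZMod 2)[X][X] →+* TwistedEnd :=
  eval₂RingHom' (aeval rhoX : (ZMod 2)[X] →ₐ[ZMod 2] TwistedEnd).toRingHom rhoY commute_aeval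

theorem rhoFree_CX : rhoFree (C X) = rhoX := by
  change eval₂ _ rhoY (C X) = _
  rw [eval₂_C]
  exact aeval_X rhoX

theorem rhoFree_X : rhoFree X = rhoY := eval₂_X _ _

theorem rhoFree_polynomial : rhoFree curve.polynomial = 0 := by
  have h : curve.polynomial = X ^ 2 + X - ((C X) ^ 3 + C X + 1) := by
    simp [WeierstrassCurve.Affine.polynomial, curve]
  refine (congrArg rhoFree h).trans ?_
  simp only [map_sub, map_add, map_pow, map_one, rhoFree_CX, rhoFree_X]
  exact sub_eq_zero.mpr rho_relation

/-- The Drinfeld module `ρ : A → K{τ}`: the ring homomorphism with `ρ(x) = ρ_x`, `ρ(y) = ρ_y`. -/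
def rho : A →+* TwistedEnd :=
  Ideal.Quotient.lift (Ideal.span {curve.polynomial}) rhoFree (by
    intro a ha
    obtain ⟨b, rfl⟩ := Ideal.mem_span_singleton'.mp ha
    rw [map_mul, rhoFree_polynomial, mul_zero])

theorem rho_xA : rho xA = rhoX := rhoFree_CX

theorem rho_yA : rho yA = rhoY := rhoFree_X

/-- `e` is the normalized exponential of `ρ`: it has the shape `e(z) = z + ∑_{i ≥ 1} aᵢ z^(2^i)`,
and `e(a z) = ρ_a(e(z))` for all `a ∈ A`. -/
structure IsExponential (e : PowerSeries K) : Prop where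
  coeff_eq_zero : ∀ n : ℕ, (∀ i : ℕ, n ≠ 2 ^ i) → PowerSeries.coeff n e = 0
  coeff_one : PowerSeries.coeff 1 e = 1
  functional : ∀ a : A, PowerSeries.rescale (algebraMap A K a) e = rho a e

theorem xK_pow_ne {n : ℕ} (hn : 2 ≤ n) : xK ^ n - xK ≠ 0 := by
  intro h
  have h1 : (algebraMap (ZMod 2)[X] A) (X ^ n - X) = 0 := by
    have h2 : algebraMap A K ((algebraMap (ZMod 2)[X] A) (X ^ n - X)) = 0 := by
      rw [map_sub, map_pow, map_sub, map_pow]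
      exact h
    exact (map_eq_zero_iff _ (IsFractionRing.injective A K)).mp h2
  have h3 : (X ^ n - X : (ZMod 2)[X]) = 0 :=
    (map_eq_zero_iff _ (FaithfulSMul.algebraMap_injective (ZMod 2)[X] A)).mp h1
  have h4 := congrArg (fun p : (ZMod 2)[X] => p.coeff 1) h3
  simp [coeff_X_pow, show ¬ (1 = n) by omega] at h4

theorem eq_zero_of_functional (h : PowerSeries K) (h0 : PowerSeries.coeff 0 h = 0)
    (h1 : PowerSeries.coeff 1 h = 0) (hx : PowerSeries.rescale xK h = rhoX h) : h = 0 := by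
  ext n
  rw [map_zero]
  induction n using Nat.strong_induction_on with
  | _ n ih =>
    rcases Nat.lt_or_ge n 2 with hn | hn
    · interval_cases n <;> assumption
    · obtain ⟨g, rfl⟩ : PowerSeries.X ^ n ∣ h := PowerSeries.X_pow_dvd_iff.mpr ih
      have hz : ∀ m : ℕ, 2 ≤ m →
          PowerSeries.coeff n ((PowerSeries.X ^ n * g) ^ m) = 0 := by
        intro m hm
        rw [mul_pow, ← pow_mul]
        refine PowerSeries.coeff_of_lt_order _ ?_
        refine lt_of_lt_of_le ?_ (PowerSeries.le_order_mul _ _)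
        rw [PowerSeries.order_X_pow]
        refine lt_of_lt_of_le ?_ le_self_add
        have : n < n * m := by nlinarith
        exact_mod_cast this
      have hc := congrArg (PowerSeries.coeff n) hx
      rw [rhoX_apply, PowerSeries.coeff_rescale, map_add, map_add, PowerSeries.coeff_C_mul,
        PowerSeries.coeff_C_mul, hz 2 le_rfl, hz 4 (by norm_num), mul_zero, add_zero,
        add_zero] at hc
      have : (xK ^ n - xK) * PowerSeries.coeff n (PowerSeries.X ^ n * g) = 0 := by
        linear_combination hc
      exact (mul_eq_zero.mp this).resolve_left (xK_pow_ne hn)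

theorem coeff_sq (f : PowerSeries K) (n : ℕ) : PowerSeries.coeff n (f ^ 2) =
    if 2 ∣ n then (PowerSeries.coeff (n / 2) f) ^ 2 else 0 := by
  have h : (f.expand 2 two_ne_zero).map (frobenius K 2) = f ^ 2 :=
    MvPowerSeries.map_frobenius_expand 2 two_ne_zero
  rw [← h, PowerSeries.coeff_map, PowerSeries.coeff_expand]
  split_ifs <;> simp [frobenius_def]

/-- The coefficients of the exponential, obtained by comparing coefficients in
`e(x z) = ρ_x(e(z))`. -/
def expFun : ℕ → K
  | 0 => 0
  | 1 => 1
  | (n + 2) =>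
    ((xK ^ 2 + xK) * (if 2 ∣ n + 2 then expFun ((n + 2) / 2) ^ 2 else 0)
      + (if 2 ∣ n + 2 then
          (if 2 ∣ (n + 2) / 2 then expFun ((n + 2) / 2 / 2) ^ 2 else 0) ^ 2 else 0))
      / (xK ^ (n + 2) - xK)
  decreasing_by all_goals omega

theorem expFun_functional_x :
    PowerSeries.rescale xK (PowerSeries.mk expFun) = rhoX (PowerSeries.mk expFun) := by
  ext n
  rw [rhoX_apply, show (PowerSeries.mk expFun) ^ 4 = ((PowerSeries.mk expFun) ^ 2) ^ 2 by ring,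
    PowerSeries.coeff_rescale, map_add, map_add, PowerSeries.coeff_C_mul, PowerSeries.coeff_C_mul,
    coeff_sq, coeff_sq, coeff_sq]
  simp only [PowerSeries.coeff_mk]
  match n with
  | 0 => simp [expFun]
  | 1 => simp [expFun]
  | n + 2 =>
    have h := xK_pow_ne (n := n + 2) (by omega)
    have h' : expFun (n + 2) * (xK ^ (n + 2) - xK) =
      (xK ^ 2 + xK) * (if 2 ∣ n + 2 then expFun ((n + 2) / 2) ^ 2 else 0)
      + (if 2 ∣ n + 2 then
          (if 2 ∣ (n + 2) / 2 then expFun ((n + 2) / 2 / 2) ^ 2 else 0) ^ 2 else 0) := by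
      rw [expFun, div_mul_cancel₀ _ h]
    linear_combination h'

theorem expFun_eq_zero (n : ℕ) (hn : ∀ i : ℕ, n ≠ 2 ^ i) : expFun n = 0 := by
  induction n using Nat.strong_induction_on with
  | _ n ih =>
    match n with
    | 0 => simp [expFun]
    | 1 => exact absurd rfl (hn 0)
    | n + 2 =>
      have key : 2 ∣ n + 2 → ∀ i : ℕ, (n + 2) / 2 ≠ 2 ^ i := fun hd i hi =>
        hn (i + 1) (by rw [pow_succ]; omega)
      have key2 : 2 ∣ n + 2 → 2 ∣ (n + 2) / 2 → ∀ i : ℕ, (n + 2) / 2 / 2 ≠ 2 ^ i :=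
        fun hd hd' i hi => key hd (i + 1) (by rw [pow_succ]; omega)
      rw [expFun]
      by_cases hd : 2 ∣ n + 2
      · rw [ih _ (by omega) (key hd)]
        by_cases hd' : 2 ∣ (n + 2) / 2
        · rw [ih _ (by omega) (key2 hd hd')]; simp
        · rw [if_neg hd']; simp
      · simp [hd]

theorem A_induction {P : A → Prop} (zero : P 0) (one : P 1) (x : P xA) (y : P yA)
    (add : ∀ a b, P a → P b → P (a + b)) (mul : ∀ a b, P a → P b → P (a * b)) (a : A) : P a := by
  have hp : ∀ p : (ZMod 2)[X], P (algebraMap (ZMod 2)[X] A p) := by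
    intro p
    induction p using Polynomial.induction_on with
    | C c =>
      have hc : ∀ b : ZMod 2, b = 0 ∨ b = 1 := by decide
      rcases hc c with rfl | rfl
      · rw [map_zero, map_zero]; exact zero
      · rw [map_one, map_one]; exact one
    | add p q hp hq => rw [map_add]; exact add _ _ hp hq
    | monomial n c h =>
      rw [pow_succ, ← mul_assoc, map_mul]
      exact mul _ _ h x
  obtain ⟨p, q, rfl⟩ := WeierstrassCurve.Affine.CoordinateRing.exists_smul_basis_eq a
  rw [Algebra.smul_def, Algebra.smul_def, mul_one]
  exact add _ _ (hp p) (mul _ _ (hp q) y)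

theorem rescale_C (c b : K) : PowerSeries.rescale c (PowerSeries.C b) = PowerSeries.C b := by
  ext n
  rw [PowerSeries.coeff_rescale, PowerSeries.coeff_C]
  split_ifs with h <;> simp [h]

theorem rescale_rho (a : A) : ∀ (c : K) (f : PowerSeries K),
    PowerSeries.rescale c (rho a f) = rho a (PowerSeries.rescale c f) := by
  induction a using A_induction with
  | zero => intro c f; simp
  | one => intro c f; simp
  | x =>
    intro c f
    rw [rho_xA, rhoX_apply, rhoX_apply]
    simp only [map_add, map_mul, map_pow, rescale_C]
  | y =>
    intro c f
    rw [rho_yA, rhoY_apply, rhoY_apply]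
    simp only [map_add, map_mul, map_pow, rescale_C]
  | add a b ha hb => intro c f; simp [ha, hb]
  | mul a b ha hb => intro c f; simp [ha, hb]

theorem rescale_add_of_additive (e : PowerSeries K)
    (h : ∀ n : ℕ, (∀ i : ℕ, n ≠ 2 ^ i) → PowerSeries.coeff n e = 0) (a b : K) :
    PowerSeries.rescale (a + b) e = PowerSeries.rescale a e + PowerSeries.rescale b e := by
  ext n
  rw [map_add, PowerSeries.coeff_rescale, PowerSeries.coeff_rescale, PowerSeries.coeff_rescale]
  by_cases hn : ∀ i : ℕ, n ≠ 2 ^ i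
  · rw [h n hn]; simp
  · push Not at hn
    obtain ⟨i, rfl⟩ := hn
    rw [add_pow_char_pow, add_mul]

/-- An additive solution of the functional equation for `x` satisfies it for all of `A`. -/
theorem functional_of_x (e : PowerSeries K)
    (h : ∀ n : ℕ, (∀ i : ℕ, n ≠ 2 ^ i) → PowerSeries.coeff n e = 0)
    (hx : PowerSeries.rescale xK e = rhoX e) (a : A) :
    PowerSeries.rescale (algebraMap A K a) e = rho a e := by
  have h0 : PowerSeries.coeff 0 e = 0 := h 0 fun i => (pow_pos two_pos i).ne
  induction a using A_induction with
  | zero =>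
    rw [map_zero, map_zero, PowerSeries.rescale_zero_apply,
      ← PowerSeries.coeff_zero_eq_constantCoeff_apply, h0]
    simp
  | one => simp
  | x => rw [rho_xA]; exact hx
  | y =>
    change PowerSeries.rescale yK e = _
    rw [← sub_eq_zero]
    refine eq_zero_of_functional _ ?_ ?_ ?_
    · rw [rho_yA, rhoY_apply]
      have h0' : PowerSeries.constantCoeff (PowerSeries.rescale yK e) = 0 := by
        rw [← PowerSeries.coeff_zero_eq_constantCoeff_apply, PowerSeries.coeff_rescale, h0,
          mul_zero]
      simp at h0
      simp [h0, h0']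
    · obtain ⟨g, rfl⟩ : PowerSeries.X ∣ e := PowerSeries.X_dvd_iff.mpr (by simpa using h0)
      have hz : ∀ m : ℕ, 2 ≤ m → PowerSeries.coeff 1 ((PowerSeries.X * g) ^ m) = 0 := by
        intro m hm
        rw [mul_pow, PowerSeries.coeff_X_pow_mul', if_neg (by omega)]
      rw [rho_yA, rhoY_apply]
      rw [map_sub, map_add, map_add, map_add, PowerSeries.coeff_rescale, PowerSeries.coeff_C_mul,
        PowerSeries.coeff_C_mul, PowerSeries.coeff_C_mul]
      rw [hz 8 (by norm_num), hz 4 (by norm_num), hz 2 le_rfl]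
      ring
    · have e1 : PowerSeries.rescale xK (PowerSeries.rescale yK e) =
          rhoX (PowerSeries.rescale yK e) := by
        rw [PowerSeries.rescale_rescale, mul_comm, ← PowerSeries.rescale_rescale, hx, ← rho_xA,
          rescale_rho]
      have e2 : PowerSeries.rescale xK (rho yA e) = rhoX (rho yA e) := by
        rw [rescale_rho, hx, ← rho_xA, ← Module.End.mul_apply, ← Module.End.mul_apply, ← map_mul,
          ← map_mul, mul_comm]
      rw [map_sub, map_sub, e1, e2]
  | add a b ha hb =>
    rw [map_add, map_add, rescale_add_of_additive e h, ha, hb, LinearMap.add_apply]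
  | mul a b ha hb =>
    rw [map_mul, map_mul, mul_comm, ← PowerSeries.rescale_rescale, hb, rescale_rho, ha,
      ← Module.End.mul_apply, ← map_mul, ← map_mul, mul_comm]

theorem existsUnique_exponential : ∃! e : PowerSeries K, IsExponential e := by
  have z0 : ∀ i : ℕ, 0 ≠ 2 ^ i := fun i => (pow_pos two_pos i).ne
  have hs : ∀ n : ℕ, (∀ i : ℕ, n ≠ 2 ^ i) → PowerSeries.coeff n (PowerSeries.mk expFun) = 0 :=
    fun n hn => by rw [PowerSeries.coeff_mk, expFun_eq_zero n hn]
  refine ⟨PowerSeries.mk expFun, ⟨hs, by simp [expFun], functional_of_x _ hs expFun_functional_x⟩, ?_⟩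
  · intro e he
    rw [← sub_eq_zero]
    refine eq_zero_of_functional _ ?_ ?_ ?_
    · rw [map_sub, he.coeff_eq_zero 0 z0]; simp [expFun]
    · rw [map_sub, he.coeff_one]; simp [expFun]
    · rw [map_sub, map_sub, expFun_functional_x, ← rho_xA, ← he.functional xA]; rfl

/-- The normalized exponential `e(z) = ∑ z^(2^i) / dᵢ` of `ρ`: the unique power series with
`IsExponential`. -/
def expSeries : PowerSeries K := existsUnique_exponential.choose

theorem isExponential_expSeries : IsExponential expSeries := existsUnique_exponential.choose_spec.1

theorem isUnit_coeff_one_expSeries : IsUnit (PowerSeries.coeff 1 expSeries) := by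
  rw [isExponential_expSeries.coeff_one]; exact isUnit_one

/-- The logarithm `log(z) = ∑ z^(2^i) / ℓᵢ`: the compositional inverse of the exponential. -/
def logSeries : PowerSeries K := expSeries.substInvOfIsUnit isUnit_coeff_one_expSeries

theorem exp_log : expSeries.subst logSeries = (PowerSeries.X : PowerSeries K) :=
  expSeries.subst_substInvOfIsUnit_right
    (by
      rw [← PowerSeries.coeff_zero_eq_constantCoeff_apply]
      exact isExponential_expSeries.coeff_eq_zero 0 fun i => (pow_pos two_pos i).ne)
    isUnit_coeff_one_expSeries

/-- `dᵢ`, where `1 / dᵢ` is the coefficient of `z^(2^i)` in the exponential. -/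
def d (i : ℕ) : K := (PowerSeries.coeff (2 ^ i) expSeries)⁻¹

/-- `ℓᵢ`, where `1 / ℓᵢ` is the coefficient of `z^(2^i)` in the logarithm. -/
def ell (i : ℕ) : K := (PowerSeries.coeff (2 ^ i) logSeries)⁻¹

/-- `p_k(w) = ∑_{j ≤ k} w^(2^j) / (d_j ℓ_{k-j}^(2^j))`. -/
def pPoly (k : ℕ) : K[X] :=
  ∑ j ∈ Finset.range (k + 1), C (1 / (d j * ell (k - j) ^ 2 ^ j)) * X ^ 2 ^ j

/-- `R_k(w) = p_k(w) / e_k(w)`, a priori a rational function of `w`. -/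
def R (k : ℕ) : RatFunc K :=
  algebraMap K[X] (RatFunc K) (pPoly k) / algebraMap K[X] (RatFunc K) (ePoly k)

/-- The constant `C = 1 / d_{k-1} + B_{k,k-2}² / d_k`, for `k ≥ 2`. -/
def constC (k : ℕ) : K := 1 / d (k - 1) + B k (k - 2) ^ 2 / d k

end DrinfeldExample

end

/-!
Since `e(a log z) = ρ_a(z)`, the polynomial `p_k(w)`, which is the coefficient of `z^(2^k)` in
`e(w log z)`, takes at `a ∈ A` the value of the coefficient of `τ^k` in `ρ_a`; this vanishes for
`deg a < k`, because `ρ_a` has `τ`-degree `deg a`. Hence `p_k` and `e_k² / d_k + C e_k` are two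
additive polynomials vanishing on the `2^(k-1)` elements of `A_{<k}`. The constant `C` makes their
coefficients at `w^(2^i)` agree for all `i ≥ k - 1`, so their difference has degree less than
`2^(k-1)` and must be zero.

The coefficients of `e` and `log` satisfy recursions read off from `ρ_x`. At a valuation with
`v(x) > 1`, which exists because `x` is not integral over `𝔽₂`, one term on the right-hand side of
each recursion dominates, so no coefficient can vanish.
-/

namespace DrinfeldExample

open scoped PowerSeries

section AdditiveSeries

/-- The additive (`p`-linearized) power series `∑ cᵢ X^(p^i)`, as a submodule of all power series.
Additive polynomials are the polynomials whose coercion to power series lies in it. -/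
def additiveSeries (p : ℕ) (S : Type*) [CommRing S] : Submodule S S⟦X⟧ where
  carrier := {f | ∀ n, (∀ i, n ≠ p ^ i) → PowerSeries.coeff n f = 0}
  zero_mem' _ _ := map_zero _
  add_mem' hf hg n hn := by rw [map_add, hf n hn, hg n hn, add_zero]
  smul_mem' c f hf n hn := by rw [map_smul, hf n hn, smul_zero]

variable {p : ℕ} {S : Type*} [CommRing S]

lemma X_pow_prime_pow_mem_additiveSeries (i : ℕ) :
    (PowerSeries.X ^ p ^ i : S⟦X⟧) ∈ additiveSeries p S :=
  fun n hn ↦ by rw [PowerSeries.coeff_X_pow, if_neg (hn i)]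

variable [Fact p.Prime]

lemma aeval_add_of_mem_additiveSeries {T : Type*} [CommRing T] [CharP T p] [Algebra S T] {P : S[X]}
    (hP : (P : S⟦X⟧) ∈ additiveSeries p S) (a b : T) :
    aeval (a + b) P = aeval a P + aeval b P := by
  simp only [aeval_eq_sum_range, ← Finset.sum_add_distrib, ← smul_add]
  refine Finset.sum_congr rfl fun n _ ↦ ?_
  by_cases hn : ∀ i, n ≠ p ^ i
  · rw [← Polynomial.coeff_coe, hP n hn, zero_smul, zero_smul]
  · push Not at hn
    obtain ⟨i, rfl⟩ := hn
    rw [add_pow_char_pow]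

lemma constantCoeff_eq_zero_of_mem_additiveSeries {f : S⟦X⟧} (hf : f ∈ additiveSeries p S) :
    PowerSeries.constantCoeff f = 0 := by
  rw [← PowerSeries.coeff_zero_eq_constantCoeff_apply]
  exact hf 0 fun i ↦ (pow_pos (Fact.out : p.Prime).pos i).ne

lemma natDegree_lt_of_mem_additiveSeries {P : S[X]}
    (hP : (P : S⟦X⟧) ∈ additiveSeries p S) {m : ℕ} (h : ∀ i, m ≤ i → P.coeff (p ^ i) = 0) :
    P.natDegree < p ^ m := by
  have hp : p.Prime := Fact.out
  by_contra! hm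
  have hlead : P.leadingCoeff = 0 := by
    by_cases hn : ∀ i, P.natDegree ≠ p ^ i
    · rw [leadingCoeff, ← coeff_coe, hP _ hn]
    · push Not at hn
      obtain ⟨i, hi⟩ := hn
      rw [leadingCoeff, hi, h i ((Nat.pow_le_pow_iff_right hp.one_lt).mp (hi ▸ hm))]
  rw [leadingCoeff_eq_zero.mp hlead, natDegree_zero] at hm
  exact (pow_pos hp.pos m).not_ge hm

lemma coeff_subst_of_mem_additiveSeries {f g : S⟦X⟧} (hf : f ∈ additiveSeries p S)
    (hg : PowerSeries.constantCoeff g = 0) {n N : ℕ} (hn : n < p ^ N) :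
    PowerSeries.coeff n (f.subst g) =
      ∑ i ∈ Finset.range N, PowerSeries.coeff (p ^ i) f * PowerSeries.coeff n (g ^ p ^ i) := by
  have hp : 1 < p := (Fact.out : p.Prime).one_lt
  rw [PowerSeries.coeff_subst' (PowerSeries.HasSubst.of_constantCoeff_zero' hg),
    finsum_eq_sum_of_support_subset (s := (Finset.range N).image (p ^ ·)),
    Finset.sum_image (Nat.pow_right_injective hp).injOn]
  · simp only [smul_eq_mul]
  · intro m hm
    rw [Function.mem_support] at hm
    simp only [Finset.coe_image, Finset.coe_range, Set.mem_image, Set.mem_Iio]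
    obtain ⟨i, rfl⟩ : ∃ i, m = p ^ i := by
      by_contra! hne
      exact hm (by rw [hf m hne, zero_smul])
    refine ⟨i, lt_of_not_ge fun hNi ↦ hm ?_, rfl⟩
    have hdvd : (PowerSeries.X : S⟦X⟧) ^ p ^ i ∣ g ^ p ^ i :=
      pow_dvd_pow_of_dvd (PowerSeries.X_dvd_iff.mpr hg) _
    have hni : n < p ^ i := hn.trans_le (Nat.pow_le_pow_right hp.le hNi)
    rw [PowerSeries.X_pow_dvd_iff.mp hdvd n hni, smul_zero]

variable [CharP S p]

lemma coeff_pow_prime_pow (f : S⟦X⟧) (i n : ℕ) :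
    PowerSeries.coeff n (f ^ p ^ i) =
      if p ^ i ∣ n then PowerSeries.coeff (n / p ^ i) f ^ p ^ i else 0 := by
  have hp : p ^ i ≠ 0 := pow_ne_zero i (Fact.out : p.Prime).ne_zero
  have hf : (f.expand (p ^ i) hp).map (iterateFrobenius S p i) = f ^ p ^ i :=
    MvPowerSeries.map_iterateFrobenius_expand p (Fact.out : p.Prime).ne_zero f i
  rw [← hf, PowerSeries.coeff_map, PowerSeries.coeff_expand, apply_ite (iterateFrobenius S p i),
    map_zero, iterateFrobenius_def]

lemma pow_prime_pow_mem_additiveSeries {f : S⟦X⟧} (hf : f ∈ additiveSeries p S) (i : ℕ) :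
    f ^ p ^ i ∈ additiveSeries p S := by
  intro n hn
  rw [coeff_pow_prime_pow]
  split_ifs with hdvd
  · obtain ⟨m, rfl⟩ := hdvd
    have hp : 0 < p ^ i := pow_pos (Fact.out : p.Prime).pos i
    rw [Nat.mul_div_cancel_left m hp, hf m fun j hj ↦ hn (i + j) (by rw [hj, pow_add]),
      zero_pow hp.ne']
  · rfl

lemma coeff_prime_pow_subst_of_mem_additiveSeries {f g : S⟦X⟧} (hf : f ∈ additiveSeries p S)
    (hg : PowerSeries.constantCoeff g = 0) (k : ℕ) :
    PowerSeries.coeff (p ^ k) (f.subst g) =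
      ∑ i ∈ Finset.range (k + 1),
        PowerSeries.coeff (p ^ i) f * PowerSeries.coeff (p ^ (k - i)) g ^ p ^ i := by
  have hp := (Fact.out : p.Prime)
  rw [coeff_subst_of_mem_additiveSeries hf hg (Nat.pow_lt_pow_right hp.one_lt k.lt_succ_self)]
  refine Finset.sum_congr rfl fun i hi ↦ ?_
  have hik : i ≤ k := Finset.mem_range_succ_iff.mp hi
  rw [coeff_pow_prime_pow, if_pos (pow_dvd_pow p hik), Nat.pow_div hik hp.pos]

-- By strong induction on `n`, comparing the coefficients of `X ^ n` in `f(g(X)) = X`: each term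
-- `g ^ p ^ i` with `i > 0` only involves the coefficients of `g` in degrees below `n`.
lemma mem_additiveSeries_of_subst_eq_X {f g : S⟦X⟧} (hf : f ∈ additiveSeries p S)
    (hf1 : PowerSeries.coeff 1 f = 1) (hg : PowerSeries.constantCoeff g = 0)
    (hfg : f.subst g = (PowerSeries.X : S⟦X⟧)) : g ∈ additiveSeries p S := by
  have hp := (Fact.out : p.Prime)
  intro n hn
  induction n using Nat.strong_induction_on with
  | _ n ih =>
    rcases n.eq_zero_or_pos with rfl | hpos
    · simpa using hg
    have hcoeff : PowerSeries.coeff n (f.subst g) = PowerSeries.coeff n g := by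
      rw [coeff_subst_of_mem_additiveSeries hf hg
        (n.lt_succ_self.trans (Nat.lt_pow_self hp.one_lt)), Finset.sum_range_succ',
        Finset.sum_eq_zero, pow_zero, hf1, one_mul, pow_one, zero_add]
      intro i _
      rw [coeff_pow_prime_pow]
      split_ifs with hdvd
      · obtain ⟨m, rfl⟩ := hdvd
        have hpi : 1 < p ^ (i + 1) := Nat.one_lt_pow i.succ_ne_zero hp.one_lt
        have hm : m < p ^ (i + 1) * m := by
          have := Nat.pos_of_mul_pos_left hpos
          nlinarith
        rw [Nat.mul_div_cancel_left m (by omega),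
          ih m hm fun j hj ↦ hn (i + 1 + j) (by rw [hj, pow_add _ (i + 1)]),
          zero_pow (by lia), mul_zero]
      · exact mul_zero _
    rw [← hcoeff, hfg, PowerSeries.coeff_X, if_neg fun h ↦ hn 0 (by rw [h, pow_zero])]

end AdditiveSeries

section SubspacePolynomial

variable {S M : Type*} [CommRing S] [AddCommGroup M]

open Classical in
lemma prod_X_add_C_union_coset (f : M →+ S) {V : AddSubgroup M} {g : M} (hg : g ∉ V) {t : Finset M}
    (ht : ∀ v, v ∈ t ↔ v ∈ V ∨ v - g ∈ V) :
    ∏ v ∈ t, (X + C (f v)) = (∏ v ∈ t with v ∈ V, (X + C (f v))) *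
      (∏ v ∈ t with v ∈ V, (X + C (f v))).comp (X + C (f g)) := by
  have hcoset : t.filter (· ∉ V) = (t.filter (· ∈ V)).map (addRightEmbedding g) := by
    ext v
    simp only [Finset.mem_filter, Finset.mem_map, addRightEmbedding_apply, ht]
    constructor
    · rintro ⟨hv | hv, hvV⟩
      · exact absurd hv hvV
      · exact ⟨v - g, ⟨.inl hv, hv⟩, sub_add_cancel v g⟩
    · rintro ⟨u, ⟨-, hu⟩, rfl⟩
      exact ⟨.inr (by rwa [add_sub_cancel_right]), fun h ↦ hg ((V.add_mem_cancel_left hu).mp h)⟩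
  rw [← Finset.prod_filter_mul_prod_filter_not t (· ∈ V), hcoset, Finset.prod_map, prod_comp]
  congr 1
  refine Finset.prod_congr rfl fun v _ ↦ ?_
  simp only [addRightEmbedding_apply, map_add, add_comp, X_comp, C_comp]
  ring

lemma mul_comp_X_add_C_mem_additiveSeries [CharP S 2] {P : S[X]}
    (hP : (P : S⟦X⟧) ∈ additiveSeries 2 S) (c : S) :
    ((P * P.comp (X + C c) : S[X]) : S⟦X⟧) ∈ additiveSeries 2 S := by
  have hcomp : P.comp (X + C c) = P + C (P.eval c) := by
    rw [comp_eq_aeval, aeval_add_of_mem_additiveSeries hP, aeval_X_left_apply, ← comp_eq_aeval,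
      comp_C]
  have hmul : P * P.comp (X + C c) = P ^ 2 ^ 1 + P.eval c • P := by
    rw [hcomp, smul_eq_C_mul]
    ring
  rw [hmul, coe_add, coe_pow, coe_smul]
  exact add_mem (pow_prime_pow_mem_additiveSeries hP 1) (Submodule.smul_mem _ _ hP)

variable [Module (ZMod 2) M]

lemma mem_span_insert_zmod_two {g v : M} {s : Set M} :
    v ∈ Submodule.span (ZMod 2) (insert g s) ↔
      v ∈ Submodule.span (ZMod 2) s ∨ v - g ∈ Submodule.span (ZMod 2) s := by
  rw [Submodule.mem_span_insert]
  constructor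
  · rintro ⟨c, z, hz, rfl⟩
    have hc : ∀ c : ZMod 2, c = 0 ∨ c = 1 := by decide
    rcases hc c with rfl | rfl
    · exact .inl (by simpa using hz)
    · exact .inr (by simpa using hz)
  · rintro (hv | hv)
    · exact ⟨0, v, hv, by simp⟩
    · exact ⟨1, v - g, hv, by simp⟩

lemma prod_X_add_C_mem_additiveSeries_of_eq_span [CharP S 2] (f : M →+ S) (s : Finset M) :
    ∀ t : Finset M, (t : Set M) = Submodule.span (ZMod 2) (s : Set M) →
      ((∏ v ∈ t, (X + C (f v)) : S[X]) : S⟦X⟧) ∈ additiveSeries 2 S := by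
  classical
  induction s using Finset.induction_on with
  | empty =>
    intro t ht
    obtain rfl : t = {0} := Finset.coe_injective (by simpa using ht)
    simpa using X_pow_prime_pow_mem_additiveSeries (p := 2) (S := S) 0
  | insert g s _ ih =>
    intro t ht
    rw [Finset.coe_insert] at ht
    set V := Submodule.span (ZMod 2) (s : Set M)
    by_cases hg : g ∈ V
    · exact ih t (by rw [ht, Submodule.span_insert_eq_span hg])
    have mem_t (v : M) : v ∈ t ↔ v ∈ V ∨ v - g ∈ V := by
      rw [← Finset.mem_coe, ht, SetLike.mem_coe, mem_span_insert_zmod_two]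
    have hV : ((t.filter (· ∈ V) : Finset M) : Set M) = V := by
      ext v
      simpa [mem_t] using Or.inl
    rw [prod_X_add_C_union_coset f (V := V.toAddSubgroup) hg mem_t]
    exact mul_comp_X_add_C_mem_additiveSeries (ih _ (by convert! hV)) _

lemma prod_X_add_C_mem_additiveSeries [CharP S 2] (f : M →+ S) {V : Submodule (ZMod 2) M}
    {t : Finset M} (ht : (t : Set M) = V) :
    ((∏ v ∈ t, (X + C (f v)) : S[X]) : S⟦X⟧) ∈ additiveSeries 2 S :=
  prod_X_add_C_mem_additiveSeries_of_eq_span f t t (by rw [ht, Submodule.span_eq])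

end SubspacePolynomial

section Valuation

lemma exists_valuationSubring_one_lt {k F : Type*} [CommRing k] [Field F] [Algebra k F] {x : F}
    (hx : ¬ IsIntegral k x) : ∃ V : ValuationSubring F, 1 < V.valuation x := by
  obtain ⟨V, -, hxV⟩ :=
    (integralClosure k F).toSubring.exists_le_valuationSubring_of_isIntegrallyClosedIn hx
  exact ⟨V, not_le.mp ((V.valuation_le_one_iff x).not.mpr hxV)⟩

variable {F Γ : Type*} [Field F] [LinearOrderedCommGroupWithZero Γ] (v : Valuation F Γ) {x : F}

lemma valuation_pow_add_self (hx : 1 < v x) {n : ℕ} (hn : 2 ≤ n) : v (x ^ n + x) = v x ^ n := by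
  rw [Valuation.map_add_eq_of_lt_left, map_pow]
  simpa using lt_self_pow₀ hx hn

lemma valuation_pow_sub_self (hx : 1 < v x) {n : ℕ} (hn : 2 ≤ n) : v (x ^ n - x) = v x ^ n := by
  rw [Valuation.map_sub_eq_of_lt_left, map_pow]
  simpa using lt_self_pow₀ hx hn

-- The invariant `t ^ 2 ^ (n + 1) * v (e (n + 2)) = v (e (n + 1)) ^ 2`, where `t = v x`, says that
-- `e (n + 1) ^ 4` dominates the right-hand side of the recursion.
lemma valuation_exp_recursion_step {e₁ e₂ e₃ : F} (hx : 1 < v x) (n : ℕ) (he₁ : e₁ ≠ 0)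
    (hv : v x ^ 2 ^ (n + 1) * v e₂ = v e₁ ^ 2)
    (hrec : (x ^ 2 ^ (n + 3) - x) * e₃ = (x ^ 2 + x) * e₂ ^ 2 + e₁ ^ 4) :
    e₂ ≠ 0 ∧ v x ^ 2 ^ (n + 2) * v e₃ = v e₂ ^ 2 := by
  have hx0 : v x ≠ 0 := (zero_lt_one.trans hx).ne'
  have he₂ : v e₂ ≠ 0 := by
    rintro h
    rw [h, mul_zero, eq_comm, pow_eq_zero_iff two_ne_zero, map_eq_zero] at hv
    exact he₁ hv
  have he₁_pow : v e₁ ^ 4 = v x ^ 2 ^ (n + 2) * v e₂ ^ 2 := by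
    rw [show v e₁ ^ 4 = (v e₁ ^ 2) ^ 2 from pow_mul _ 2 2, ← hv, mul_pow, ← pow_mul, ← pow_succ]
  refine ⟨(map_ne_zero v).mp he₂, mul_left_cancel₀ (pow_ne_zero (2 ^ (n + 2)) hx0) ?_⟩
  calc v x ^ 2 ^ (n + 2) * (v x ^ 2 ^ (n + 2) * v e₃) = v ((x ^ 2 ^ (n + 3) - x) * e₃) := by
        rw [map_mul, valuation_pow_sub_self v hx (Nat.le_self_pow (by lia) 2), ← mul_assoc,
          ← pow_add, ← two_mul, ← pow_succ']
    _ = v (e₁ ^ 4) := by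
        rw [hrec, Valuation.map_add_eq_of_lt_right]
        rw [map_mul, valuation_pow_add_self v hx le_rfl, map_pow, map_pow, he₁_pow]
        gcongr
        · exact zero_lt_iff.mpr (pow_ne_zero 2 he₂)
        · exact lt_self_pow₀ one_lt_two (by lia)
    _ = v x ^ 2 ^ (n + 2) * v e₂ ^ 2 := by rw [map_pow, he₁_pow]

lemma ne_zero_of_exp_recursion {e : ℕ → F} (hx : 1 < v x) (h0 : e 0 = 1) (h1 : e 1 = 1)
    (hrec : ∀ n, (x ^ 2 ^ (n + 2) - x) * e (n + 2) = (x ^ 2 + x) * e (n + 1) ^ 2 + e n ^ 4)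
    (n : ℕ) : e n ≠ 0 := by
  have hx0 : v x ≠ 0 := (zero_lt_one.trans hx).ne'
  have key (n : ℕ) : e (n + 1) ≠ 0 ∧ v x ^ 2 ^ (n + 1) * v (e (n + 2)) = v (e (n + 1)) ^ 2 := by
    induction n with
    | zero =>
      have hsum : v (x ^ 2 + x + 1) = v x ^ 2 := by
        rw [Valuation.map_add_eq_of_lt_left, valuation_pow_add_self v hx le_rfl]
        rw [map_one, valuation_pow_add_self v hx le_rfl]
        exact one_lt_pow₀ hx two_ne_zero
      have h2 := congrArg v (hrec 0)
      simp only [zero_add, h0, h1, one_pow, mul_one, map_mul, hsum] at h2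
      rw [valuation_pow_sub_self v hx (by norm_num)] at h2
      refine ⟨by simp [h1], mul_left_cancel₀ (pow_ne_zero 2 hx0) ?_⟩
      simpa only [zero_add, h1, map_one, one_pow, pow_one, mul_one, ← mul_assoc, ← pow_add,
        Nat.reduceAdd, Nat.reducePow] using h2
    | succ n ih => exact valuation_exp_recursion_step v hx n ih.1 ih.2 (hrec (n + 1))
  obtain _ | n := n
  · simp [h0]
  · exact (key n).1

lemma valuation_eq_one_of_log_recursion {l : ℕ → F} (hx : 1 < v x) (h0 : l 0 = 1) (h1 : l 1 = 1)
    (hrec : ∀ n, (x ^ 2 ^ (n + 2) - x) * l (n + 2) =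
      -((x ^ 2 + x) ^ 2 ^ (n + 1) * l (n + 1) + l n)) (n : ℕ) :
    v (l n) = 1 := by
  induction n using Nat.twoStepInduction with
  | zero => rw [h0, map_one]
  | one => rw [h1, map_one]
  | more n ih₀ ih₁ =>
    have hx0 : v x ≠ 0 := (zero_lt_one.trans hx).ne'
    have hl : v x ^ 2 ^ (n + 2) * v (l (n + 2)) = v x ^ 2 ^ (n + 2) := by
      calc v x ^ 2 ^ (n + 2) * v (l (n + 2)) = v ((x ^ 2 ^ (n + 2) - x) * l (n + 2)) := by
            rw [map_mul, valuation_pow_sub_self v hx (Nat.le_self_pow (by omega) 2)]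
        _ = v ((x ^ 2 + x) ^ 2 ^ (n + 1) * l (n + 1)) := by
            rw [hrec, Valuation.map_neg, Valuation.map_add_eq_of_lt_left]
            rw [map_mul, map_pow, ih₀, ih₁, mul_one, valuation_pow_add_self v hx le_rfl]
            exact one_lt_pow₀ (one_lt_pow₀ hx two_ne_zero) (by positivity)
        _ = v x ^ 2 ^ (n + 2) := by
            rw [map_mul, map_pow, ih₁, mul_one, valuation_pow_add_self v hx le_rfl,
              ← pow_mul, ← pow_succ']
    exact mul_left_cancel₀ (pow_ne_zero _ hx0) (hl.trans (mul_one _).symm)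

end Valuation

lemma expSeries_mem_additiveSeries : expSeries ∈ additiveSeries 2 K :=
  isExponential_expSeries.coeff_eq_zero

lemma constantCoeff_logSeries : PowerSeries.constantCoeff logSeries = 0 :=
  PowerSeries.constantCoeff_substInvOfIsUnit _ isUnit_coeff_one_expSeries

lemma hasSubst_logSeries : PowerSeries.HasSubst logSeries :=
  .of_constantCoeff_zero' constantCoeff_logSeries

lemma logSeries_mem_additiveSeries : logSeries ∈ additiveSeries 2 K :=
  mem_additiveSeries_of_subst_eq_X expSeries_mem_additiveSeries isExponential_expSeries.coeff_one
    constantCoeff_logSeries exp_log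

lemma eval_pPoly (k : ℕ) (w : K) : (pPoly k).eval w =
    PowerSeries.coeff (2 ^ k) (expSeries.subst (PowerSeries.C w * logSeries)) := by
  rw [coeff_prime_pow_subst_of_mem_additiveSeries expSeries_mem_additiveSeries
    (by rw [map_mul, constantCoeff_logSeries, mul_zero]), pPoly, eval_finsetSum]
  refine Finset.sum_congr rfl fun j _ ↦ ?_
  simp only [eval_mul, eval_C, eval_pow, eval_X, PowerSeries.coeff_C_mul, d, ell, one_div,
    mul_inv, inv_pow, inv_inv]
  ring

lemma rho_subst (a : A) (f : K⟦X⟧) {g : K⟦X⟧} (hg : PowerSeries.HasSubst g) :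
    (rho a f).subst g = rho a (f.subst g) := by
  have subst_C_mul (c : K) (f : K⟦X⟧) :
      (PowerSeries.C c * f).subst g = PowerSeries.C c * f.subst g := by
    simp only [← PowerSeries.smul_eq_C_mul, PowerSeries.subst_smul hg]
  induction a using A_induction generalizing f with
  | zero => simp only [map_zero, LinearMap.zero_apply, ← PowerSeries.coe_substAlgHom hg]
  | one => simp only [map_one, Module.End.one_apply]
  | x =>
    simp only [rho_xA, rhoX_apply, PowerSeries.subst_add hg, subst_C_mul, PowerSeries.subst_pow hg]
  | y =>
    simp only [rho_yA, rhoY_apply, PowerSeries.subst_add hg, subst_C_mul, PowerSeries.subst_pow hg]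
  | add a b ha hb =>
    simp only [map_add, LinearMap.add_apply, PowerSeries.subst_add hg, ha, hb]
  | mul a b ha hb => simp only [map_mul, Module.End.mul_apply, ha, hb]

lemma expSeries_subst_C_mul_logSeries (a : A) :
    expSeries.subst (PowerSeries.C (algebraMap A K a) * logSeries) = rho a PowerSeries.X := by
  have hX : PowerSeries.HasSubst (algebraMap A K a • PowerSeries.X : K⟦X⟧) :=
    .of_constantCoeff_zero' (by simp)
  rw [← exp_log, ← rho_subst a _ hasSubst_logSeries, ← isExponential_expSeries.functional,
    PowerSeries.rescale_eq_subst, PowerSeries.subst_comp_subst_apply hX hasSubst_logSeries,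
    PowerSeries.subst_smul hasSubst_logSeries, PowerSeries.subst_X hasSubst_logSeries,
    PowerSeries.smul_eq_C_mul]

lemma eval_pPoly_algebraMap (k : ℕ) (a : A) : (pPoly k).eval (algebraMap A K a) =
    PowerSeries.coeff (2 ^ k) (rho a PowerSeries.X) := by
  rw [eval_pPoly, expSeries_subst_C_mul_logSeries]

lemma logSeries_subst_rho_X (a : A) :
    logSeries.subst (rho a PowerSeries.X) = PowerSeries.C (algebraMap A K a) * logSeries := by
  have hexp := constantCoeff_eq_zero_of_mem_additiveSeries expSeries_mem_additiveSeries
  have log_exp : logSeries.subst expSeries = (PowerSeries.X : K⟦X⟧) :=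
    expSeries.subst_substInvOfIsUnit_left hexp isUnit_coeff_one_expSeries
  have hlog : PowerSeries.HasSubst (PowerSeries.C (algebraMap A K a) * logSeries) :=
    .of_constantCoeff_zero' (by rw [map_mul, constantCoeff_logSeries, mul_zero])
  rw [← expSeries_subst_C_mul_logSeries,
    ← PowerSeries.subst_comp_subst_apply (.of_constantCoeff_zero' hexp) hlog, log_exp,
    PowerSeries.subst_X hlog]

lemma coeff_sq_two_pow (f : K⟦X⟧) (n : ℕ) :
    PowerSeries.coeff (2 ^ (n + 1)) (f ^ 2) = PowerSeries.coeff (2 ^ n) f ^ 2 := by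
  rw [coeff_sq, pow_succ, if_pos (dvd_mul_left _ _), Nat.mul_div_cancel _ two_pos]

lemma coeff_one_sq (f : K⟦X⟧) : PowerSeries.coeff (2 ^ 0) (f ^ 2) = 0 := by
  rw [coeff_sq, if_neg (by decide)]

lemma coeff_one_rhoX (f : K⟦X⟧) :
    PowerSeries.coeff (2 ^ 0) (rhoX f) = xK * PowerSeries.coeff (2 ^ 0) f := by
  rw [rhoX_apply, show f ^ 4 = (f ^ 2) ^ 2 by ring, map_add, map_add, PowerSeries.coeff_C_mul,
    PowerSeries.coeff_C_mul, coeff_one_sq, coeff_one_sq, mul_zero, add_zero, add_zero]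

lemma coeff_two_rhoX (f : K⟦X⟧) : PowerSeries.coeff (2 ^ 1) (rhoX f) =
    xK * PowerSeries.coeff (2 ^ 1) f + (xK ^ 2 + xK) * PowerSeries.coeff (2 ^ 0) f ^ 2 := by
  rw [rhoX_apply, show f ^ 4 = (f ^ 2) ^ 2 by ring, map_add, map_add, PowerSeries.coeff_C_mul,
    PowerSeries.coeff_C_mul, coeff_sq_two_pow, coeff_sq_two_pow, coeff_one_sq,
    zero_pow two_ne_zero, add_zero]

lemma coeff_two_pow_rhoX (f : K⟦X⟧) (n : ℕ) : PowerSeries.coeff (2 ^ (n + 2)) (rhoX f) =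
    xK * PowerSeries.coeff (2 ^ (n + 2)) f + (xK ^ 2 + xK) * PowerSeries.coeff (2 ^ (n + 1)) f ^ 2 +
      PowerSeries.coeff (2 ^ n) f ^ 4 := by
  rw [rhoX_apply, show f ^ 4 = (f ^ 2) ^ 2 by ring, map_add, map_add, PowerSeries.coeff_C_mul,
    PowerSeries.coeff_C_mul, coeff_sq_two_pow, coeff_sq_two_pow, coeff_sq_two_pow, ← pow_mul]

lemma coeff_two_pow_rhoY (f : K⟦X⟧) (n : ℕ) : PowerSeries.coeff (2 ^ (n + 3)) (rhoY f) =
    yK * PowerSeries.coeff (2 ^ (n + 3)) f + (yK ^ 2 + yK) * PowerSeries.coeff (2 ^ (n + 2)) f ^ 2 +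
      xK * (yK ^ 2 + yK) * PowerSeries.coeff (2 ^ (n + 1)) f ^ 4 +
      PowerSeries.coeff (2 ^ n) f ^ 8 := by
  rw [rhoY_apply, show f ^ 4 = (f ^ 2) ^ 2 by ring, show f ^ 8 = ((f ^ 2) ^ 2) ^ 2 by ring,
    map_add, map_add, map_add, PowerSeries.coeff_C_mul, PowerSeries.coeff_C_mul,
    PowerSeries.coeff_C_mul, coeff_sq_two_pow, coeff_sq_two_pow, coeff_sq_two_pow,
    coeff_sq_two_pow, coeff_sq_two_pow, coeff_sq_two_pow, ← pow_mul, ← pow_mul, ← pow_mul]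

lemma coeff_two_pow_X (n : ℕ) :
    PowerSeries.coeff (2 ^ n) (PowerSeries.X : K⟦X⟧) = if n = 0 then 1 else 0 := by
  simp only [PowerSeries.coeff_X, Nat.pow_eq_one, OfNat.ofNat_ne_one, false_or]

lemma coeff_expSeries_zero : PowerSeries.coeff (2 ^ 0) expSeries = 1 :=
  isExponential_expSeries.coeff_one

lemma rescale_xK_expSeries : PowerSeries.rescale xK expSeries = rhoX expSeries := by
  rw [← rho_xA]
  exact isExponential_expSeries.functional xA

lemma coeff_expSeries_one : PowerSeries.coeff (2 ^ 1) expSeries = 1 := by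
  have h := congrArg (PowerSeries.coeff (2 ^ 1)) rescale_xK_expSeries
  rw [PowerSeries.coeff_rescale, coeff_two_rhoX, coeff_expSeries_zero] at h
  refine mul_left_cancel₀ (xK_pow_ne le_rfl) ?_
  linear_combination h + xK * CharTwo.two_eq_zero (R := K)

lemma coeff_expSeries_recursion (n : ℕ) :
    (xK ^ 2 ^ (n + 2) - xK) * PowerSeries.coeff (2 ^ (n + 2)) expSeries =
      (xK ^ 2 + xK) * PowerSeries.coeff (2 ^ (n + 1)) expSeries ^ 2 +
        PowerSeries.coeff (2 ^ n) expSeries ^ 4 := by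
  have h := congrArg (PowerSeries.coeff (2 ^ (n + 2))) rescale_xK_expSeries
  rw [PowerSeries.coeff_rescale, coeff_two_pow_rhoX] at h
  linear_combination h

lemma sum_coeff_expSeries_mul_coeff_logSeries (k : ℕ) :
    ∑ i ∈ Finset.range (k + 1), PowerSeries.coeff (2 ^ i) expSeries *
      PowerSeries.coeff (2 ^ (k - i)) logSeries ^ 2 ^ i = if k = 0 then 1 else 0 := by
  rw [← coeff_prime_pow_subst_of_mem_additiveSeries expSeries_mem_additiveSeries
    constantCoeff_logSeries, exp_log, PowerSeries.coeff_X]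
  simp only [Nat.pow_eq_one, OfNat.ofNat_ne_one, false_or]

lemma coeff_logSeries_zero : PowerSeries.coeff (2 ^ 0) logSeries = 1 := by
  simpa [coeff_expSeries_zero, isExponential_expSeries.coeff_one] using
    sum_coeff_expSeries_mul_coeff_logSeries 0

lemma coeff_logSeries_one : PowerSeries.coeff (2 ^ 1) logSeries = 1 := by
  have h := sum_coeff_expSeries_mul_coeff_logSeries 1
  rw [Finset.sum_range_succ, Finset.sum_range_one, coeff_expSeries_zero, coeff_expSeries_one,
    Nat.sub_self, coeff_logSeries_zero] at h
  simpa [CharTwo.add_eq_zero] using h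

lemma coeff_one_rhoX_X : PowerSeries.coeff (2 ^ 0) (rhoX PowerSeries.X) = xK := by
  rw [coeff_one_rhoX, coeff_two_pow_X, if_pos rfl, mul_one]

lemma coeff_two_rhoX_X : PowerSeries.coeff (2 ^ 1) (rhoX PowerSeries.X) = xK ^ 2 + xK := by
  rw [coeff_two_rhoX, coeff_two_pow_X, coeff_two_pow_X, if_neg one_ne_zero, if_pos rfl, mul_zero,
    zero_add, one_pow, mul_one]

lemma coeff_two_pow_rhoX_X (n : ℕ) :
    PowerSeries.coeff (2 ^ (n + 2)) (rhoX PowerSeries.X) = if n = 0 then 1 else 0 := by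
  rw [coeff_two_pow_rhoX, coeff_two_pow_X, coeff_two_pow_X, coeff_two_pow_X]
  simp

lemma coeff_logSeries_recursion (n : ℕ) :
    (xK ^ 2 ^ (n + 2) - xK) * PowerSeries.coeff (2 ^ (n + 2)) logSeries =
      -((xK ^ 2 + xK) ^ 2 ^ (n + 1) * PowerSeries.coeff (2 ^ (n + 1)) logSeries +
        PowerSeries.coeff (2 ^ n) logSeries) := by
  have hsubst : logSeries.subst (rhoX PowerSeries.X) = PowerSeries.C xK * logSeries := by
    rw [← rho_xA]
    exact logSeries_subst_rho_X xA
  have hX : PowerSeries.constantCoeff (rhoX PowerSeries.X) = 0 := by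
    simp [rhoX_apply]
  have hsum : ∀ i ∈ Finset.range n, PowerSeries.coeff (2 ^ i) logSeries *
      PowerSeries.coeff (2 ^ (n + 2 - i)) (rhoX PowerSeries.X) ^ 2 ^ i = 0 := by
    intro i hi
    have hi : i < n := Finset.mem_range.mp hi
    rw [show n + 2 - i = n - i + 2 by lia, coeff_two_pow_rhoX_X, if_neg (by lia),
      zero_pow (by positivity), mul_zero]
  have h := congrArg (PowerSeries.coeff (2 ^ (n + 2))) hsubst
  rw [coeff_prime_pow_subst_of_mem_additiveSeries logSeries_mem_additiveSeries hX,
    Finset.sum_range_succ, Finset.sum_range_succ, Finset.sum_range_succ, Finset.sum_eq_zero hsum,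
    show n + 2 - n = 0 + 2 by lia, show n + 2 - (n + 1) = 1 by lia, Nat.sub_self,
    coeff_two_pow_rhoX_X, coeff_two_rhoX_X, coeff_one_rhoX_X, if_pos rfl, one_pow,
    PowerSeries.coeff_C_mul] at h
  linear_combination h

lemma not_isIntegral_xK : ¬ IsIntegral (ZMod 2) xK := by
  have hinj : Function.Injective (algebraMap (ZMod 2)[X] K) := by
    rw [IsScalarTower.algebraMap_eq (ZMod 2)[X] A K]
    exact (IsFractionRing.injective A K).comp (FaithfulSMul.algebraMap_injective (ZMod 2)[X] A)
  have : Transcendental (ZMod 2) (algebraMap (ZMod 2)[X] K X) :=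
    (transcendental_algebraMap_iff hinj).mpr (Polynomial.transcendental_X _)
  exact fun h ↦ this h.isAlgebraic

lemma d_ne_zero (j : ℕ) : d j ≠ 0 := by
  obtain ⟨V, hV⟩ := exists_valuationSubring_one_lt not_isIntegral_xK
  exact inv_ne_zero (ne_zero_of_exp_recursion V.valuation
    (e := fun j ↦ PowerSeries.coeff (2 ^ j) expSeries) hV coeff_expSeries_zero coeff_expSeries_one
    coeff_expSeries_recursion j)

lemma ell_ne_zero (j : ℕ) : ell j ≠ 0 := by
  obtain ⟨V, hV⟩ := exists_valuationSubring_one_lt not_isIntegral_xK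
  have h : V.valuation (PowerSeries.coeff (2 ^ j) logSeries) = 1 :=
    valuation_eq_one_of_log_recursion V.valuation (l := fun j ↦ PowerSeries.coeff (2 ^ j) logSeries)
      hV coeff_logSeries_zero coeff_logSeries_one coeff_logSeries_recursion j
  exact inv_ne_zero ((map_ne_zero V.valuation).mp (h ▸ one_ne_zero))

/-- The isomorphism `𝔽₂[x] ⊕ 𝔽₂[x] ≃ A` given by the `𝔽₂[x]`-basis `1, y` of `A`. -/
noncomputable def coordEquiv : ((ZMod 2)[X] × (ZMod 2)[X]) ≃ₗ[ZMod 2] A :=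
  .ofBijective (((LinearMap.toSpanSingleton (ZMod 2)[X] A 1).coprod
      (LinearMap.toSpanSingleton (ZMod 2)[X] A yA)).restrictScalars (ZMod 2)) <| by
    constructor
    · rw [← LinearMap.ker_eq_bot, LinearMap.ker_eq_bot']
      rintro ⟨p, q⟩ h
      exact Prod.ext_iff.mpr (WeierstrassCurve.Affine.CoordinateRing.smul_basis_eq_zero h)
    · intro a
      obtain ⟨p, q, h⟩ := WeierstrassCurve.Affine.CoordinateRing.exists_smul_basis_eq a
      exact ⟨(p, q), h⟩

lemma coordEquiv_apply (p q : (ZMod 2)[X]) : coordEquiv (p, q) = p • 1 + q • yA :=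
  rfl

/-- `A_{<k}` as an `𝔽₂`-subspace of `A`. In the basis `1, y`, the condition
`max (2 deg p) (2 deg q + 3) < k` bounds the degrees of both coordinates. -/
noncomputable def degLT (k : ℕ) : Submodule (ZMod 2) A :=
  ((degreeLT (ZMod 2) ((k + 1) / 2)).prod (degreeLT (ZMod 2) ((k - 2) / 2))).map
    coordEquiv.toLinearMap

lemma coordEquiv_mem_degLT {k : ℕ} {p q : (ZMod 2)[X]} : coordEquiv (p, q) ∈ degLT k ↔
    p.degree < ((k + 1) / 2 : ℕ) ∧ q.degree < ((k - 2) / 2 : ℕ) := by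
  simp [degLT, mem_degreeLT]

lemma two_nsmul_add_lt_iff {n : WithBot ℕ} {c k m : ℕ} (h : ∀ i, 2 * i + c < k ↔ i < m) :
    2 • n + (c : WithBot ℕ) < k ↔ n < m := by
  induction n with
  | bot => simp
  | coe i =>
    rw [two_nsmul]
    exact WithBot.coe_lt_coe.trans ((two_mul i ▸ h i).trans WithBot.coe_lt_coe.symm)

lemma mem_degLT {k : ℕ} {a : A} : a ∈ degLT k ↔ deg a < k := by
  obtain ⟨⟨p, q⟩, rfl⟩ := coordEquiv.surjective a
  rw [coordEquiv_mem_degLT, coordEquiv_apply, deg_eq, max_lt_iff]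
  refine and_congr ?_ ?_
  · simpa using (two_nsmul_add_lt_iff (n := p.degree) (c := 0) (by lia)).symm
  · exact (two_nsmul_add_lt_iff (c := 3) (by lia)).symm

lemma coe_Alt (k : ℕ) : (Alt k : Set A) = degLT k := by
  ext a
  simp [Alt, mem_degLT]

lemma natCard_degreeLT (S : Type*) [Semiring S] (n : ℕ) :
    Nat.card (degreeLT S n) = Nat.card S ^ n := by
  rw [Nat.card_congr (degreeLTEquiv S n).toEquiv, Nat.card_fun, Nat.card_fin]

lemma card_Alt {k : ℕ} (hk : 2 ≤ k) : (Alt k).card = 2 ^ (k - 1) := by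
  calc (Alt k).card = Nat.card (degLT k) := by
        rw [← SetLike.coe_sort_coe, ← coe_Alt, Nat.card_coe_set_eq, Set.ncard_coe_finset]
    _ = Nat.card (degreeLT (ZMod 2) ((k + 1) / 2) × degreeLT (ZMod 2) ((k - 2) / 2)) :=
        Nat.card_congr ((coordEquiv.submoduleMap _).symm.toEquiv.trans (Equiv.Set.prod _ _))
    _ = 2 ^ (k - 1) := by
        rw [Nat.card_prod, natCard_degreeLT, natCard_degreeLT, Nat.card_zmod, ← pow_add]
        congr 1
        lia

section TauDegree

/-- The power series with vanishing coefficient at `X ^ 2 ^ i` for all `i ≥ m`. On additive series,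
this is the condition `deg_τ < m`. -/
def tauDegreeLT (m : ℕ) : Submodule K K⟦X⟧ where
  carrier := {f | ∀ i, m ≤ i → PowerSeries.coeff (2 ^ i) f = 0}
  zero_mem' _ _ := map_zero _
  add_mem' hf hg i hi := by rw [map_add, hf i hi, hg i hi, add_zero]
  smul_mem' c f hf i hi := by rw [map_smul, hf i hi, smul_zero]

variable {f : K⟦X⟧} {m n : ℕ}

lemma tauDegreeLT_mono (h : m ≤ n) : tauDegreeLT m ≤ tauDegreeLT n :=
  fun _ hf i hi ↦ hf i (h.trans hi)

lemma X_mem_tauDegreeLT : PowerSeries.X ∈ tauDegreeLT 1 :=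
  fun i hi ↦ by rw [coeff_two_pow_X, if_neg (by lia)]

lemma rhoX_mem_tauDegreeLT (hf : f ∈ tauDegreeLT m) : rhoX f ∈ tauDegreeLT (m + 2) := by
  intro i hi
  obtain ⟨i, rfl⟩ := Nat.exists_eq_add_of_le' (Nat.le_of_add_left_le hi)
  rw [coeff_two_pow_rhoX, hf _ (by lia), hf _ (by lia), hf _ (by lia)]
  ring

lemma rhoY_mem_tauDegreeLT (hf : f ∈ tauDegreeLT m) : rhoY f ∈ tauDegreeLT (m + 3) := by
  intro i hi
  obtain ⟨i, rfl⟩ := Nat.exists_eq_add_of_le' (Nat.le_of_add_left_le hi)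
  rw [coeff_two_pow_rhoY, hf _ (by lia), hf _ (by lia), hf _ (by lia), hf _ (by lia)]
  ring

lemma rho_xA_pow_mem_tauDegreeLT (hf : f ∈ tauDegreeLT m) (i : ℕ) :
    rho (xA ^ i) f ∈ tauDegreeLT (m + 2 * i) := by
  induction i with
  | zero => simpa using hf
  | succ i ih =>
    rw [pow_succ', map_mul, Module.End.mul_apply, rho_xA]
    exact rhoX_mem_tauDegreeLT ih

lemma rho_smul_one_mem_tauDegreeLT (hf : f ∈ tauDegreeLT m) {N : ℕ} (hN : m + 2 * n ≤ N + 2)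
    {p : (ZMod 2)[X]} (hp : p ∈ degreeLT (ZMod 2) n) : rho (p • 1) f ∈ tauDegreeLT N := by
  rw [degreeLT_eq_span_X_pow] at hp
  induction hp using Submodule.span_induction with
  | mem p hp =>
    obtain ⟨i, hi, rfl⟩ : ∃ i < n, X ^ i = p := by simpa using hp
    have hx : (X ^ i : (ZMod 2)[X]) • (1 : A) = xA ^ i := by
      rw [← Algebra.algebraMap_eq_smul_one, map_pow]
      rfl
    rw [hx]
    exact tauDegreeLT_mono (by lia) (rho_xA_pow_mem_tauDegreeLT hf i)
  | zero => simp only [zero_smul, map_zero, LinearMap.zero_apply, zero_mem]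
  | add p q _ _ hp hq =>
    rw [add_smul, map_add, LinearMap.add_apply]
    exact add_mem hp hq
  | smul c p _ hp =>
    obtain rfl | rfl : c = 0 ∨ c = 1 := by decide +revert
    · simp only [zero_smul, map_zero, LinearMap.zero_apply, zero_mem]
    · rwa [one_smul]

lemma rho_X_mem_tauDegreeLT {k : ℕ} (hk : 2 ≤ k) {a : A} (ha : a ∈ degLT k) :
    rho a PowerSeries.X ∈ tauDegreeLT k := by
  obtain ⟨⟨p, q⟩, rfl⟩ := coordEquiv.surjective a
  obtain ⟨hp, hq⟩ := coordEquiv_mem_degLT.mp ha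
  have hy : rho yA PowerSeries.X ∈ tauDegreeLT 4 := by
    rw [rho_yA]
    exact rhoY_mem_tauDegreeLT X_mem_tauDegreeLT
  have hsplit : rho (coordEquiv (p, q)) PowerSeries.X =
      rho (p • 1) PowerSeries.X + rho (q • 1) (rho yA PowerSeries.X) := by
    rw [coordEquiv_apply, map_add, LinearMap.add_apply, ← Module.End.mul_apply, ← map_mul,
      smul_one_mul]
  rw [hsplit]
  exact add_mem (rho_smul_one_mem_tauDegreeLT X_mem_tauDegreeLT (by lia) (mem_degreeLT.mpr hp))
    (rho_smul_one_mem_tauDegreeLT hy (by lia) (mem_degreeLT.mpr hq))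

end TauDegree

lemma eval_pPoly_of_mem_Alt {k : ℕ} (hk : 2 ≤ k) {a : A} (ha : a ∈ Alt k) :
    (pPoly k).eval (algebraMap A K a) = 0 := by
  have ha : a ∈ degLT k := by rwa [← SetLike.mem_coe, ← coe_Alt]
  rw [eval_pPoly_algebraMap]
  exact rho_X_mem_tauDegreeLT hk ha k le_rfl

lemma eval_ePoly_of_mem_Alt {k : ℕ} {a : A} (ha : a ∈ Alt k) :
    (ePoly k).eval (algebraMap A K a) = 0 := by
  rw [ePoly, eval_prod]
  refine Finset.prod_eq_zero ha ?_
  rw [eval_add, eval_X, eval_C, CharTwo.add_self_eq_zero]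

lemma monic_ePoly (k : ℕ) : (ePoly k).Monic :=
  monic_prod_of_monic _ _ fun _ _ ↦ monic_X_add_C _

lemma natDegree_ePoly {k : ℕ} (hk : 2 ≤ k) : (ePoly k).natDegree = 2 ^ (k - 1) := by
  rw [ePoly, natDegree_prod_of_monic _ _ fun a _ ↦ monic_X_add_C _]
  simp only [natDegree_X_add_C, Finset.sum_const, smul_eq_mul, mul_one, card_Alt hk]

lemma ePoly_mem_additiveSeries (k : ℕ) : (ePoly k : K⟦X⟧) ∈ additiveSeries 2 K :=
  prod_X_add_C_mem_additiveSeries (algebraMap A K).toAddMonoidHom (coe_Alt k)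

lemma pPoly_mem_additiveSeries (k : ℕ) : (pPoly k : K⟦X⟧) ∈ additiveSeries 2 K := by
  rw [pPoly, ← coeToPowerSeries.ringHom_apply, map_sum]
  refine sum_mem fun j _ ↦ ?_
  rw [← smul_eq_C_mul, coeToPowerSeries.ringHom_apply, coe_smul, coe_pow, coe_X]
  exact Submodule.smul_mem _ _ (X_pow_prime_pow_mem_additiveSeries j)

lemma coeff_pPoly (k i : ℕ) : (pPoly k).coeff (2 ^ i) =
    if i ≤ k then 1 / (d i * ell (k - i) ^ 2 ^ i) else 0 := by
  simp only [pPoly, finsetSum_coeff, coeff_C_mul, coeff_X_pow, Nat.pow_right_inj one_lt_two,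
    mul_ite, mul_one, mul_zero, Finset.sum_ite_eq, Finset.mem_range_succ_iff]

lemma coeff_ePoly_sq (k i : ℕ) : (ePoly k ^ 2).coeff (2 ^ (i + 1)) = B k i ^ 2 := by
  rw [← coeff_coe, coe_pow, coeff_sq_two_pow, coeff_coe, B]

lemma B_self_sub_one {k : ℕ} (hk : 2 ≤ k) : B k (k - 1) = 1 := by
  rw [B, ← natDegree_ePoly hk]
  exact monic_ePoly k

lemma B_eq_zero {k i : ℕ} (hk : 2 ≤ k) (hi : k ≤ i) : B k i = 0 :=
  coeff_eq_zero_of_natDegree_lt <| by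
    rw [natDegree_ePoly hk]
    exact Nat.pow_lt_pow_right one_lt_two (by lia)

lemma ell_zero : ell 0 = 1 := by
  rw [ell, coeff_logSeries_zero, inv_one]

lemma ell_one : ell 1 = 1 := by
  rw [ell, coeff_logSeries_one, inv_one]

lemma coeff_pPoly_eq {k i : ℕ} (hk : 2 ≤ k) (hi : k - 1 ≤ i) : (pPoly k).coeff (2 ^ i) =
    (C (1 / d k) * ePoly k ^ 2 + C (constC k) * ePoly k).coeff (2 ^ i) := by
  obtain ⟨m, rfl⟩ := Nat.exists_eq_add_of_le' hk
  obtain ⟨i, rfl⟩ := Nat.exists_eq_add_of_le' (Nat.le_of_add_left_le hi)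
  have hB : B (m + 2) (m + 1) = 1 := B_self_sub_one hk
  rw [coeff_pPoly, coeff_add, coeff_C_mul, coeff_C_mul, coeff_ePoly_sq, ← B]
  obtain rfl | rfl | h : i = m ∨ i = m + 1 ∨ m + 2 ≤ i := by lia
  · rw [if_pos (by lia), show i + 2 - (i + 1) = 1 by lia, ell_one, hB, constC,
      show i + 2 - 1 = i + 1 by lia, Nat.add_sub_cancel, one_pow, mul_one, mul_one]
    linear_combination -(B (i + 2) i ^ 2 / d (i + 2)) * CharTwo.two_eq_zero (R := K)
  · rw [if_pos le_rfl, Nat.sub_self, ell_zero, hB, B_eq_zero hk le_rfl, one_pow, one_pow, mul_one,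
      mul_one, mul_zero, add_zero]
  · rw [if_neg (by lia), B_eq_zero hk h, B_eq_zero hk (by lia)]
    ring

lemma pPoly_eq {k : ℕ} (hk : 2 ≤ k) :
    pPoly k = C (1 / d k) * ePoly k ^ 2 + C (constC k) * ePoly k := by
  have he := ePoly_mem_additiveSeries k
  set q : K[X] := C (1 / d k) * ePoly k ^ 2 + C (constC k) * ePoly k with hq
  have hq_mem : (q : K⟦X⟧) ∈ additiveSeries 2 K := by
    rw [hq, ← smul_eq_C_mul, ← smul_eq_C_mul, coe_add, coe_smul, coe_smul, coe_pow]
    exact add_mem (Submodule.smul_mem _ _ (pow_prime_pow_mem_additiveSeries he 1))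
      (Submodule.smul_mem _ _ he)
  have hdeg : (pPoly k - q).natDegree < 2 ^ (k - 1) := by
    refine natDegree_lt_of_mem_additiveSeries (p := 2) ?_ fun i hi ↦ ?_
    · rw [coe_sub]
      exact sub_mem (pPoly_mem_additiveSeries k) hq_mem
    · rw [coeff_sub, coeff_pPoly_eq hk hi, sub_self]
  classical
  refine sub_eq_zero.mp (eq_zero_of_natDegree_lt_card_of_eval_eq_zero' _
    ((Alt k).image (algebraMap A K)) ?_ ?_)
  · intro w hw
    obtain ⟨a, ha, rfl⟩ := Finset.mem_image.mp hw
    simp [hq, eval_pPoly_of_mem_Alt hk ha, eval_ePoly_of_mem_Alt ha]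
  · rwa [Finset.card_image_of_injective _ (IsFractionRing.injective A K), card_Alt hk]

end DrinfeldExample

theorem mainTheorem2 (k : ℕ) (hk : 2 ≤ k) :
    (∀ j : ℕ, DrinfeldExample.d j ≠ 0 ∧ DrinfeldExample.ell j ≠ 0) ∧
    DrinfeldExample.ePoly k ∣ DrinfeldExample.pPoly k ∧
    DrinfeldExample.R k = algebraMap (Polynomial DrinfeldExample.K) (RatFunc DrinfeldExample.K)
      (Polynomial.C (1 / DrinfeldExample.d k) * DrinfeldExample.ePoly k
        + Polynomial.C (DrinfeldExample.constC k)) ∧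
    DrinfeldExample.pPoly k =
      Polynomial.C (1 / DrinfeldExample.d k) * DrinfeldExample.ePoly k ^ 2
        + Polynomial.C (DrinfeldExample.constC k) * DrinfeldExample.ePoly k := by
  have hp := DrinfeldExample.pPoly_eq hk
  have hfactor : DrinfeldExample.pPoly k =
      (C (1 / DrinfeldExample.d k) * DrinfeldExample.ePoly k + C (DrinfeldExample.constC k)) *
        DrinfeldExample.ePoly k := by
    rw [hp]
    ring
  refine ⟨fun j ↦ ⟨DrinfeldExample.d_ne_zero j, DrinfeldExample.ell_ne_zero j⟩,
    Dvd.intro_left _ hfactor.symm, ?_, hp⟩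
  rw [DrinfeldExample.R, hfactor, map_mul, mul_div_cancel_right₀]
  exact RatFunc.algebraMap_ne_zero (DrinfeldExample.monic_ePoly k).ne_zero
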